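/- Let $n\ge 1$ and let $Ty_n$ be classical simple type theory with primitive types $t$ (truth values) and $e_1,\dots,e_n$ (individuals), function types $\alpha\beta$ (functions from $\alpha$ to $\beta$) and product types $\alpha\times\beta$, with terms built from typed variables, non-logical constants and description operators $\iota_{(\alpha t)\alpha}$ by application, abstraction, equality, pairing and projections, and axiomatized as Andrews' system $Q_0$ (extended by several sorts, by pairing axioms, and by $\iota\,(\lambda x_\alpha.\,y_\alpha=x_\alpha)=y_\alpha$ for each type $\alpha$). Let $\mathcal A=\{a_1,\dots,a_N\}$ be a finite alphabet with $N\neq 1$, write $s=e_n$, and suppose that the constants include $\mathbf C^0_s,\mathbf C^1_s,\dots,\mathbf C^N_s$ and a binary operation $+$ on type $s$. Let $Ty_n^{\mathcal A}$ be the extension of $Ty_n$ by the axioms $\forall x_s\,(x+\mathbf C^0=x\wedge \mathbf C^0+x=x)$, $\forall x_s y_s z_s\,((x+y)+z=x+(y+z))$ and $\forall x_s y_s z_s\,(x+\mathbf C^i+y\neq x+\mathbf C^j+z)$ for $1\le i<j\le N$. For a word $w\in\mathcal A^*$ let $T_A(w)$ be the $s$-term given by $T_A(\varepsilon)=\mathbf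 C^0_s$, $T_A(a_i)=\mathbf C^i_s$, $T_A(a_iw)=\mathbf C^i_s+T_A(w)$ for $w\ne\varepsilon$. Fix a type $\alpha$. An $\alpha$-language is a set $\mathcal L$ of pairs $(w,A)$ of a word $w\in\mathcal A^*$ and a (possibly open) term $A$ of type $\alpha$ of $Ty_n^{\mathcal A}$. It is logically closed if $(w,B),(w,C)\in\mathcal L$ and $\vdash A=B\vee A=C$ in $Ty_n^{\mathcal A}$ imply $(w,A)\in\mathcal L$. The logical closure of a language is the least logically closed language that includes it, and a lexicon is the logical closure of a finite $\alpha$-language. Let $Ty_n^{\mathcal A+}$ be any extension of $Ty_n^{\mathcal A}$ by (possibly no) new non-logical constants. A term $L$ of type $s\alpha t$ of $Ty_n^{\mathcal A+}$ represents $\mathcal L$ if, for all words $w$ and all $\alpha$-terms $A$ of $Ty_n^{\mathcal A}$, $$(w,A)\in\mathcal L\iff\ \vdash L\;T_A(w)\;A\quad\text{in } Ty_n^{\mathcal A+}.$$ A canonic representation of $\mathcal L$ is a term $L$ that represents $\mathcal L$ and for which there are $l\ge 0$, words $w_1,\dots,w_l$ and $\alpha$-terms $A_1,\dots,A_l$ of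 $Ty_n^{\mathcal A}$ with $$\vdash L=\lambda x_s\,\lambda y_\alpha\bigl((x=T_A(w_1)\wedge y=A_1)\vee\dots\vee(x=T_A(w_l)\wedge y=A_l)\bigr),$$ where $x,y$ are not free in the $A_i$; the right-hand side is also written $(=T_A(w_1))\times(=A_1)\vee\dots\vee(=T_A(w_l))\times(=A_l)$, and it is $\lambda x_s\lambda y_\alpha\,\mathrm F$ (with $\mathrm F$ falsity) for $l=0$. **Theorem.** A logically closed $\alpha$-language $\mathcal L$ has a canonic representation in $Ty_n^{\mathcal A+}$ if and only if it is a lexicon. Moreover, if $\mathcal L$ is the logical closure of the finite language $\{(w_1,A_1),\dots,(w_l,A_l)\}$, then the term $(=T_A(w_1))\times(=A_1)\vee\dots\vee(=T_A(w_l))\times(=A_l)$ represents $\mathcal L$. -/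

import Mathlib

universe u v

namespace TyN

/-! ### Types and terms of the sorted type theory -/

/-- Types over `n` sorts of individuals: the truth type, the individual types, functional types
(`fn α β` is the type of functions from `α` to `β`) and product types. -/
inductive Ty (n : ℕ) : Type
  | truth : Ty n
  | ind : Fin n → Ty n
  | fn : Ty n → Ty n → Ty n
  | prod : Ty n → Ty n → Ty n

/-- The symbolic type: the last of the `n` individual types. -/
def Ty.sym {n : ℕ} [NeZero n] : Ty n :=
  .ind ⟨n - 1, Nat.sub_lt (NeZero.pos n) Nat.one_pos⟩

/-- Bound variables: typed de Bruijn indices into the list of enclosing binders. -/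
inductive BVar {n : ℕ} : List (Ty n) → Ty n → Type
  | here {Γ : List (Ty n)} {α : Ty n} : BVar (α :: Γ) α
  | there {Γ : List (Ty n)} {α β : Ty n} : BVar Γ α → BVar (β :: Γ) α

/-- Terms with non-logical constants from `C`, inside binders of the types listed in `Γ`. Terms
are taken up to renaming of bound variables, which are de Bruijn indices; the free variables
are the `free α i`, infinitely many for each type. The terms of type `α` proper (open or closed)
are the elements of `Term C [] α`. `iota α` is the description operator. -/
inductive Term {n : ℕ} (C : Ty n → Type u) : List (Ty n) → Ty n → Type u
  | bound {Γ : List (Ty n)} {α : Ty n} : BVar Γ α → Term C Γ α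
  | free {Γ : List (Ty n)} (α : Ty n) (i : ℕ) : Term C Γ α
  | const {Γ : List (Ty n)} {α : Ty n} : C α → Term C Γ α
  | iota {Γ : List (Ty n)} (α : Ty n) : Term C Γ (.fn (.fn α .truth) α)
  | app {Γ : List (Ty n)} {α β : Ty n} : Term C Γ (.fn α β) → Term C Γ α → Term C Γ β
  | lam {Γ : List (Ty n)} {α β : Ty n} : Term C (α :: Γ) β → Term C Γ (.fn α β)
  | eq {Γ : List (Ty n)} {α : Ty n} : Term C Γ α → Term C Γ α → Term C Γ .truth
  | pair {Γ : List (Ty n)} {α β : Ty n} : Term C Γ α → Term C Γ β → Term C Γ (.prod α β)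
  | fst {Γ : List (Ty n)} {α β : Ty n} : Term C Γ (.prod α β) → Term C Γ α
  | snd {Γ : List (Ty n)} {α β : Ty n} : Term C Γ (.prod α β) → Term C Γ β

namespace Term

variable {n : ℕ} {C : Ty n → Type u}

/-! ### Renaming and capture-avoiding substitution of de Bruijn indices -/

/-- Extension of a renaming under one binder. -/
def liftRen {Γ Δ : List (Ty n)} {γ : Ty n} (ρ : ∀ α, BVar Γ α → BVar Δ α) :
    ∀ α, BVar (γ :: Γ) α → BVar (γ :: Δ) α
  | _, .here => .here
  | _, .there x => .there (ρ _ x)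

def rename : ∀ {Γ Δ : List (Ty n)} {α : Ty n}, (∀ β, BVar Γ β → BVar Δ β) →
    Term C Γ α → Term C Δ α
  | _, _, _, ρ, bound x => bound (ρ _ x)
  | _, _, _, _, free α i => free α i
  | _, _, _, _, const c => const c
  | _, _, _, _, iota α => iota α
  | _, _, _, ρ, app A B => app (rename ρ A) (rename ρ B)
  | _, _, _, ρ, lam A => lam (rename (liftRen ρ) A)
  | _, _, _, ρ, eq A B => eq (rename ρ A) (rename ρ B)
  | _, _, _, ρ, pair A B => pair (rename ρ A) (rename ρ B)
  | _, _, _, ρ, fst A => fst (rename ρ A)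
  | _, _, _, ρ, snd A => snd (rename ρ A)

/-- The same term, regarded inside one further binder that does not bind anything in it. -/
def weaken {Γ : List (Ty n)} {α γ : Ty n} (A : Term C Γ α) : Term C (γ :: Γ) α :=
  rename (fun _ x => .there x) A

/-- Extension of a substitution under one binder. -/
def liftSub {Γ Δ : List (Ty n)} {γ : Ty n} (σ : ∀ α, BVar Γ α → Term C Δ α) :
    ∀ α, BVar (γ :: Γ) α → Term C (γ :: Δ) α
  | _, .here => bound .here
  | _, .there x => weaken (σ _ x)

def subst : ∀ {Γ Δ : List (Ty n)} {α : Ty n}, (∀ β, BVar Γ β → Term C Δ β) →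
    Term C Γ α → Term C Δ α
  | _, _, _, σ, bound x => σ _ x
  | _, _, _, _, free α i => free α i
  | _, _, _, _, const c => const c
  | _, _, _, _, iota α => iota α
  | _, _, _, σ, app A B => app (subst σ A) (subst σ B)
  | _, _, _, σ, lam A => lam (subst (liftSub σ) A)
  | _, _, _, σ, eq A B => eq (subst σ A) (subst σ B)
  | _, _, _, σ, pair A B => pair (subst σ A) (subst σ B)
  | _, _, _, σ, fst A => fst (subst σ A)
  | _, _, _, σ, snd A => snd (subst σ A)

/-- The substitution of `B` for the innermost bound variable. -/
def instSub {Γ : List (Ty n)} {γ : Ty n} (B : Term C Γ γ) : ∀ α, BVar (γ :: Γ) α → Term C Γ α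
  | _, .here => B
  | _, .there x => bound x

/-- `A.inst B` is `A` with `B` substituted for the innermost bound variable. -/
def inst {Γ : List (Ty n)} {α γ : Ty n} (A : Term C (γ :: Γ) α) (B : Term C Γ γ) : Term C Γ α :=
  subst (instSub B) A

/-- Translation of terms along a map of constants. -/
def mapConst {C' : Ty n → Type v} (f : ∀ α, C α → C' α) :
    ∀ {Γ : List (Ty n)} {α : Ty n}, Term C Γ α → Term C' Γ α
  | _, _, bound x => bound x
  | _, _, free α i => free α i
  | _, _, const c => const (f _ c)
  | _, _, iota α => iota α
  | _, _, app A B => app (mapConst f A) (mapConst f B)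
  | _, _, lam A => lam (mapConst f A)
  | _, _, eq A B => eq (mapConst f A) (mapConst f B)
  | _, _, pair A B => pair (mapConst f A) (mapConst f B)
  | _, _, fst A => fst (mapConst f A)
  | _, _, snd A => snd (mapConst f A)

/-! ### Logical connectives, defined from equality -/

variable {Γ : List (Ty n)}

/-- `T := (λ x, x) = (λ x, x)`, with `x` of the truth type. -/
def tru : Term C Γ .truth :=
  eq (lam (α := .truth) (bound .here)) (lam (α := .truth) (bound .here))

/-- `∀ x, A := (λ x, T) = (λ x, A)`. -/
def all {α : Ty n} (A : Term C (α :: Γ) .truth) : Term C Γ .truth :=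
  eq (lam tru) (lam A)

/-- `F := ∀ x, x`, with `x` of the truth type. -/
def fls : Term C Γ .truth :=
  all (α := .truth) (bound .here)

/-- `¬ A := (F = A)`. -/
def neg (A : Term C Γ .truth) : Term C Γ .truth :=
  eq fls A

/-- Conjunction as a closed term: `λ x, λ y, (λ g, g T T) = (λ g, g x y)`. -/
def conjOp : Term C Γ (.fn .truth (.fn .truth .truth)) :=
  lam (lam (eq
    (lam (α := .fn .truth (.fn .truth .truth)) (app (app (bound .here) tru) tru))
    (lam (α := .fn .truth (.fn .truth .truth))
      (app (app (bound .here) (bound (.there (.there .here)))) (bound (.there .here))))))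

def conj (A B : Term C Γ .truth) : Term C Γ .truth :=
  app (app conjOp A) B

/-- Disjunction as a closed term: `λ x, λ y, ¬ (¬ x ∧ ¬ y)`. -/
def disjOp : Term C Γ (.fn .truth (.fn .truth .truth)) :=
  lam (lam (neg (conj (neg (bound (.there .here))) (neg (bound .here)))))

def disj (A B : Term C Γ .truth) : Term C Γ .truth :=
  app (app disjOp A) B

/-- Implication as a closed term: `λ x, λ y, x = (x ∧ y)`. -/
def impOp : Term C Γ (.fn .truth (.fn .truth .truth)) :=
  lam (lam (eq (bound (.there .here)) (conj (bound (.there .here)) (bound .here))))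

def imp (A B : Term C Γ .truth) : Term C Γ .truth :=
  app (app impOp A) B

/-! ### Shortcuts for predicates and relations -/

/-- `(= B) := λ x, x = B`. -/
def eqTo {α : Ty n} (B : Term C Γ α) : Term C Γ (.fn α .truth) :=
  lam (eq (bound .here) (weaken B))

/-- `A × B := λ x, λ y, A x ∧ B y`, for predicates `A` and `B`. -/
def cross {α β : Ty n} (A : Term C Γ (.fn α .truth)) (B : Term C Γ (.fn β .truth)) :
    Term C Γ (.fn α (.fn β .truth)) :=
  lam (lam (conj (app (weaken (weaken A)) (bound (.there .here)))
    (app (weaken (weaken B)) (bound .here))))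

/-- `A ∨ B := λ x, A x ∨ B x`, for predicates `A` and `B`. -/
def predOr {α : Ty n} (A B : Term C Γ (.fn α .truth)) : Term C Γ (.fn α .truth) :=
  lam (disj (app (weaken A) (bound .here)) (app (weaken B) (bound .here)))

/-- `A ∨ B := λ x, A x ∨ B x`, for binary relations, where `A x` and `B x` are predicates. -/
def relOr {α β : Ty n} (A B : Term C Γ (.fn α (.fn β .truth))) :
    Term C Γ (.fn α (.fn β .truth)) :=
  lam (predOr (app (weaken A) (bound .here)) (app (weaken B) (bound .here)))

end Term

/-! ### The signature and the deductive system -/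

/-- The non-logical constants, for an alphabet of `N` letters: a constant of symbolic type for the
empty word and one for each letter, the concatenation constant, and arbitrary further constants
`κ α` of each type `α`. -/
inductive Const {n : ℕ} [NeZero n] (N : ℕ) (κ : Ty n → Type u) : Ty n → Type u
  | nil : Const N κ Ty.sym
  | letter : Fin N → Const N κ Ty.sym
  | cat : Const N κ (.fn Ty.sym (.fn Ty.sym Ty.sym))
  | other {α : Ty n} : κ α → Const N κ α

section

variable {n : ℕ} [NeZero n] {N : ℕ} {κ : Ty n → Type u}

/-- Terms over the signature `Const N κ`. -/
abbrev Tm (N : ℕ) (κ : Ty n → Type u) (Γ : List (Ty n)) (α : Ty n) : Type u :=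
  Term (Const N κ) Γ α

variable {Γ : List (Ty n)}

def nilT : Tm N κ Γ Ty.sym := .const .nil

def letterT (a : Fin N) : Tm N κ Γ Ty.sym := .const (.letter a)

def catT (A B : Tm N κ Γ Ty.sym) : Tm N κ Γ Ty.sym := .app (.app (.const .cat) A) B

/-- `Repl A B D E`: the term `E` arises from `D` by replacing one occurrence of `A` by `B`. The
occurrence may be inside binders of `D`, which may bind variables of `A` and `B`. -/
inductive Repl {Γ₀ : List (Ty n)} {α : Ty n} (A B : Tm N κ Γ₀ α) :
    ∀ {Γ : List (Ty n)} {β : Ty n}, Tm N κ Γ β → Tm N κ Γ β → Prop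
  | here : Repl A B A B
  | appL {Γ : List (Ty n)} {β γ : Ty n} {D E : Tm N κ Γ (.fn β γ)} (G : Tm N κ Γ β) :
      Repl A B D E → Repl A B (.app D G) (.app E G)
  | appR {Γ : List (Ty n)} {β γ : Ty n} (G : Tm N κ Γ (.fn β γ)) {D E : Tm N κ Γ β} :
      Repl A B D E → Repl A B (.app G D) (.app G E)
  | lam {Γ : List (Ty n)} {β γ : Ty n} {D E : Tm N κ (β :: Γ) γ} :
      Repl A B D E → Repl A B (.lam D) (.lam E)
  | eqL {Γ : List (Ty n)} {β : Ty n} {D E : Tm N κ Γ β} (G : Tm N κ Γ β) :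
      Repl A B D E → Repl A B (.eq D G) (.eq E G)
  | eqR {Γ : List (Ty n)} {β : Ty n} (G : Tm N κ Γ β) {D E : Tm N κ Γ β} :
      Repl A B D E → Repl A B (.eq G D) (.eq G E)
  | pairL {Γ : List (Ty n)} {β γ : Ty n} {D E : Tm N κ Γ β} (G : Tm N κ Γ γ) :
      Repl A B D E → Repl A B (.pair D G) (.pair E G)
  | pairR {Γ : List (Ty n)} {β γ : Ty n} (G : Tm N κ Γ β) {D E : Tm N κ Γ γ} :
      Repl A B D E → Repl A B (.pair G D) (.pair G E)
  | fst {Γ : List (Ty n)} {β γ : Ty n} {D E : Tm N κ Γ (.prod β γ)} :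
      Repl A B D E → Repl A B (.fst D) (.fst E)
  | snd {Γ : List (Ty n)} {β γ : Ty n} {D E : Tm N κ Γ (.prod β γ)} :
      Repl A B D E → Repl A B (.snd D) (.snd E)

open Term in
/-- Provability: Andrews' system `Q₀` with sorts, products and descriptions at all types, and the
axioms of the symbolic type (unit, associativity, distinctness of letters). Axioms with free
variables are stated as schemata; `Prov (Γ := Γ) A` allows free variables from `Γ` in `A`. -/
inductive Prov : ∀ {Γ : List (Ty n)}, Tm N κ Γ .truth → Prop
  /-- The truth values are `T` and `F`: `(G T ∧ G F) = ∀ x, G x`. -/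
  | bool {Γ : List (Ty n)} (G : Tm N κ Γ (.fn .truth .truth)) :
      Prov (eq (conj (app G tru) (app G fls)) (all (app (weaken G) (bound .here))))
  /-- `A = B → H A = H B`. -/
  | leibniz {Γ : List (Ty n)} {α : Ty n} (A B : Tm N κ Γ α) (H : Tm N κ Γ (.fn α .truth)) :
      Prov (imp (eq A B) (eq (app H A) (app H B)))
  /-- Extensionality: `(F = G) = ∀ x, F x = G x`. -/
  | funext {Γ : List (Ty n)} {α β : Ty n} (F G : Tm N κ Γ (.fn α β)) :
      Prov (eq (eq F G)
        (all (eq (app (weaken F) (bound .here)) (app (weaken G) (bound .here)))))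
  /-- Conversion: `(λ x, A) B = A[B / x]`. -/
  | beta {Γ : List (Ty n)} {α β : Ty n} (A : Tm N κ (α :: Γ) β) (B : Tm N κ Γ α) :
      Prov (eq (app (lam A) B) (A.inst B))
  /-- Description: `ι (λ x, A = x) = A`. -/
  | descr {Γ : List (Ty n)} {α : Ty n} (A : Tm N κ Γ α) :
      Prov (eq (app (iota α) (lam (eq (weaken A) (bound .here)))) A)
  | fst_pair {Γ : List (Ty n)} {α β : Ty n} (A : Tm N κ Γ α) (B : Tm N κ Γ β) :
      Prov (eq (fst (pair A B)) A)
  | snd_pair {Γ : List (Ty n)} {α β : Ty n} (A : Tm N κ Γ α) (B : Tm N κ Γ β) :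
      Prov (eq (snd (pair A B)) B)
  | pair_eta {Γ : List (Ty n)} {α β : Ty n} (A : Tm N κ Γ (.prod α β)) :
      Prov (eq (pair (fst A) (snd A)) A)
  /-- `∀ x, (x + ε = x) ∧ (ε + x = x)`. -/
  | unit {Γ : List (Ty n)} :
      Prov (Γ := Γ) (all (conj (eq (catT (bound .here) nilT) (bound .here))
        (eq (catT nilT (bound .here)) (bound .here))))
  /-- `∀ x y z, (x + y) + z = x + (y + z)`. -/
  | assoc {Γ : List (Ty n)} :
      Prov (Γ := Γ) (all (all (all (eq
        (catT (catT (bound (.there (.there .here))) (bound (.there .here))) (bound .here))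
        (catT (bound (.there (.there .here))) (catT (bound (.there .here)) (bound .here)))))))
  /-- `∀ x y z, x + a + y ≠ x + b + z`, for distinct letters `a` and `b`. -/
  | letters {Γ : List (Ty n)} (a b : Fin N) (hab : a < b) :
      Prov (Γ := Γ) (all (all (all (neg (eq
        (catT (catT (bound (.there (.there .here))) (letterT a)) (bound (.there .here)))
        (catT (catT (bound (.there (.there .here))) (letterT b)) (bound .here)))))))
  /-- Rule R: from `A = B` and `D`, infer the result of replacing one occurrence of `A` in `D`
  by `B`. -/
  | ruleR {Γ₀ Γ : List (Ty n)} {α : Ty n} {A B : Tm N κ Γ₀ α} {D E : Tm N κ Γ .truth} :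
      Prov (eq A B) → Prov D → Repl A B D E → Prov E

/-! ### Languages -/

/-- The term `T_A(w)` that denotes the word `w`. -/
def wordT : List (Fin N) → Tm N κ Γ Ty.sym
  | [] => nilT
  | [a] => letterT a
  | a :: b :: w => catT (letterT a) (wordT (b :: w))

/-- An `α`-language: a set of pairs of a word and a term of type `α`, open terms included. -/
abbrev Lang (N : ℕ) (κ : Ty n → Type u) (α : Ty n) : Type u :=
  Set (List (Fin N) × Tm N κ [] α)

variable {α : Ty n}

def LogicallyClosed (L : Lang N κ α) : Prop :=
  ∀ (w : List (Fin N)) (A B D : Tm N κ [] α), (w, B) ∈ L → (w, D) ∈ L →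
    Prov (Term.disj (.eq A B) (.eq A D)) → (w, A) ∈ L

/-- `K` is the logical closure of `L`: the least logically closed language that includes `L`. -/
def IsLogicalClosure (K L : Lang N κ α) : Prop :=
  IsLeast {M : Lang N κ α | LogicallyClosed M ∧ L ⊆ M} K

/-- A lexicon: the logical closure of a finite language. -/
def IsLexicon (K : Lang N κ α) : Prop :=
  ∃ L : Lang N κ α, L.Finite ∧ IsLogicalClosure K L

/-- The term `(= T_A(w₁)) × (= A₁) ∨ … ∨ (= T_A(wₗ)) × (= Aₗ)`; for `l = 0` it is
`λ x, λ y, F`. -/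
def canonicTerm : List (List (Fin N) × Tm N κ [] α) → Tm N κ [] (.fn Ty.sym (.fn α .truth))
  | [] => .lam (.lam Term.fls)
  | [p] => Term.cross (Term.eqTo (wordT p.1)) (Term.eqTo p.2)
  | p :: q :: G => Term.relOr (Term.cross (Term.eqTo (wordT p.1)) (Term.eqTo p.2))
      (canonicTerm (q :: G))

/-! ### Extensions by further constants, and representations -/

/-- The family of further constants `κ`, extended by the new constants `ξ`. -/
abbrev extend (κ : Ty n → Type u) (ξ : Ty n → Type v) : Ty n → Type (max u v) :=
  fun α => κ α ⊕ ξ α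

def Const.toExt (ξ : Ty n → Type v) : ∀ α : Ty n, Const N κ α → Const N (extend κ ξ) α
  | _, .nil => .nil
  | _, .letter a => .letter a
  | _, .cat => .cat
  | _, .other c => .other (.inl c)

/-- A term, regarded as a term over the signature extended by the constants `ξ`. -/
def toExt (ξ : Ty n → Type v) (A : Tm N κ Γ α) : Tm N (extend κ ξ) Γ α :=
  A.mapConst (Const.toExt ξ)

/-- The language `L` is represented by the term `R` of the extension by the constants `ξ`. -/
def Represents (ξ : Ty n → Type v) (R : Tm N (extend κ ξ) [] (.fn Ty.sym (.fn α .truth)))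
    (L : Lang N κ α) : Prop :=
  ∀ (w : List (Fin N)) (A : Tm N κ [] α),
    (w, A) ∈ L ↔ Prov (.app (.app R (wordT w)) (toExt ξ A))

/-- The term `canonicTerm G`, formed in the extension by the constants `ξ`. -/
def canonicTermExt (ξ : Ty n → Type v) (G : List (List (Fin N) × Tm N κ [] α)) :
    Tm N (extend κ ξ) [] (.fn Ty.sym (.fn α .truth)) :=
  canonicTerm (G.map fun p => (p.1, toExt ξ p.2))

/-- `L` has a canonic representation, by a term of the extension by the constants `ξ`. -/
def HasCanonicRep (ξ : Ty n → Type v) (L : Lang N κ α) : Prop :=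
  ∃ R : Tm N (extend κ ξ) [] (.fn Ty.sym (.fn α .truth)), Represents ξ R L ∧
    ∃ G : List (List (Fin N) × Tm N κ [] α), Prov (.eq R (canonicTermExt ξ G))

end

end TyN

/-!
Adding constants is conservative, since new constants can be replaced by free variables, so it is
enough to compare, in the original signature, the language `K` of the canonic term of a list `G`
with the logical closure of `G`. By Leibniz' law `K` is logically closed, and it clearly
contains `G`.

Conversely, the axioms of the symbolic type refute `T_A(u) = T_A(v)` for distinct words. So if
`(w, A)` is in `K`, then `A = B₁ ∨ … ∨ A = Bₖ` is provable, where the `Bᵢ` are the terms listed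
under `w` in `G`. For `k = 0` this contradicts consistency, which is witnessed by the standard
model over the free monoid. For `k ≥ 2` let `P x` be `x = B₂ ∨ … ∨ x = Bₖ` and put
`D := if P A then A else B₂`, definable through the description operator. Then `P D` and
`A = B₁ ∨ A = D` are provable, so that induction on `k` leads from binary to longer disjunctions.
-/

namespace TyN

/-! ### Substitution -/

namespace Term

variable {n : ℕ} {C : Ty n → Type u} {Γ Δ Θ : List (Ty n)} {α γ : Ty n}

theorem subst_rename (ρ : ∀ α, BVar Γ α → BVar Δ α) (σ : ∀ α, BVar Δ α → Term C Θ α)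
    (A : Term C Γ α) : subst σ (rename ρ A) = subst (fun α x => σ α (ρ α x)) A := by
  induction A generalizing Δ Θ with
  | lam A ih =>
    simp only [rename, subst, ih]
    congr 2
    funext α x
    cases x <;> rfl
  | _ => simp_all only [rename, subst]

theorem subst_bound (A : Term C Γ α) : subst (fun _ x => bound x) A = A := by
  induction A with
  | @lam Γ β _ A ih =>
    have lift_bound : liftSub (C := C) (γ := β) (fun _ (x : BVar Γ _) => bound x) =
        fun _ x => bound x := by
      funext α x
      cases x <;> rfl
    simp only [subst, lift_bound, ih]
  | _ => simp_all only [subst]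

theorem rename_eq_subst (ρ : ∀ α, BVar Γ α → BVar Δ α) (A : Term C Γ α) :
    rename ρ A = subst (fun α x => bound (ρ α x)) A := by
  rw [← subst_bound (rename ρ A), subst_rename]

theorem rename_rename (ρ : ∀ α, BVar Γ α → BVar Δ α) (ρ' : ∀ α, BVar Δ α → BVar Θ α)
    (A : Term C Γ α) : rename ρ' (rename ρ A) = rename (fun α x => ρ' α (ρ α x)) A := by
  rw [rename_eq_subst, subst_rename, ← rename_eq_subst]

theorem rename_weaken (ρ : ∀ α, BVar Γ α → BVar Δ α) (A : Term C Γ α) :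
    rename (liftRen ρ) (weaken (γ := γ) A) = weaken (rename ρ A) := by
  rw [weaken, weaken, rename_rename, rename_rename]
  rfl

theorem rename_subst (ρ : ∀ α, BVar Δ α → BVar Θ α) (σ : ∀ α, BVar Γ α → Term C Δ α)
    (A : Term C Γ α) : rename ρ (subst σ A) = subst (fun α x => rename ρ (σ α x)) A := by
  induction A generalizing Δ Θ with
  | lam A ih =>
    simp only [rename, subst, ih]
    congr 2
    funext α x
    cases x
    · rfl
    · exact rename_weaken _ _
  | _ => simp_all only [rename, subst]

theorem subst_liftSub_weaken (σ : ∀ α, BVar Γ α → Term C Δ α) (A : Term C Γ α) :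
    subst (liftSub (γ := γ) σ) (weaken A) = weaken (subst σ A) :=
  (subst_rename _ _ A).trans (rename_subst _ σ A).symm

theorem subst_instSub_weaken (A : Term C Γ α) (B : Term C Γ γ) :
    subst (instSub B) (weaken A) = A :=
  (subst_rename _ _ A).trans (subst_bound A)

theorem inst_weaken (A : Term C Γ α) (B : Term C Γ γ) : (weaken A).inst B = A :=
  subst_instSub_weaken A B

theorem inst_rename_liftRen_there (A : Term C (γ :: Γ) α) :
    (rename (liftRen fun _ x => .there x) A).inst (bound .here) = A := by
  rw [inst, subst_rename]
  refine Eq.trans ?_ (subst_bound A)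
  congr 1
  funext α x
  cases x <;> rfl

theorem subst_neg (σ : ∀ α, BVar Γ α → Term C Δ α) (A : Term C Γ .truth) :
    subst σ (neg A) = neg (subst σ A) := rfl

theorem subst_conj (σ : ∀ α, BVar Γ α → Term C Δ α) (A B : Term C Γ .truth) :
    subst σ (conj A B) = conj (subst σ A) (subst σ B) := rfl

theorem subst_disj (σ : ∀ α, BVar Γ α → Term C Δ α) (A B : Term C Γ .truth) :
    subst σ (disj A B) = disj (subst σ A) (subst σ B) := rfl

theorem subst_imp (σ : ∀ α, BVar Γ α → Term C Δ α) (A B : Term C Γ .truth) :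
    subst σ (imp A B) = imp (subst σ A) (subst σ B) := rfl

end Term

/-! ### Equational and propositional reasoning -/

namespace Prov

open Term

variable {n : ℕ} [NeZero n] {N : ℕ} {κ : Ty n → Type u} {Γ : List (Ty n)} {α β γ : Ty n}

theorem refl (A : Tm N κ Γ α) : Prov (eq A A) := by
  have h := beta (weaken (γ := α) A) A
  rw [inst_weaken] at h
  exact ruleR h h (.eqL _ .here)

theorem symm {A B : Tm N κ Γ α} (h : Prov (eq A B)) : Prov (eq B A) :=
  ruleR h (refl A) (.eqL _ .here)

theorem trans {A B D : Tm N κ Γ α} (h : Prov (eq A B)) (h' : Prov (eq B D)) : Prov (eq A D) :=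
  ruleR h' h (.eqR _ .here)

theorem eq_mp {A B : Tm N κ Γ .truth} (h : Prov (eq A B)) (hA : Prov A) : Prov B :=
  ruleR h hA .here

theorem eq_mpr {A B : Tm N κ Γ .truth} (h : Prov (eq A B)) (hB : Prov B) : Prov A :=
  eq_mp h.symm hB

theorem congr_app {A A' : Tm N κ Γ (.fn α β)} {B B' : Tm N κ Γ α} (h : Prov (eq A A'))
    (h' : Prov (eq B B')) : Prov (eq (app A B) (app A' B')) :=
  ruleR h' (ruleR h (refl _) (.eqR _ (.appL _ .here))) (.eqR _ (.appR _ .here))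

theorem congr_eq {A A' B B' : Tm N κ Γ α} (h : Prov (eq A A')) (h' : Prov (eq B B')) :
    Prov (eq (eq A B) (eq A' B')) :=
  ruleR h' (ruleR h (refl _) (.eqR _ (.eqL _ .here))) (.eqR _ (.eqR _ .here))

theorem congr_lam {A A' : Tm N κ (α :: Γ) β} (h : Prov (eq A A')) :
    Prov (eq (lam A) (lam A')) :=
  ruleR h (refl _) (.eqR _ (.lam .here))

theorem congr_all {A A' : Tm N κ (α :: Γ) .truth} (h : Prov (eq A A')) :
    Prov (eq (all A) (all A')) :=
  congr_eq (refl _) (congr_lam h)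

theorem congr_conj {A A' B B' : Tm N κ Γ .truth} (h : Prov (eq A A')) (h' : Prov (eq B B')) :
    Prov (eq (conj A B) (conj A' B')) :=
  congr_app (congr_app (refl _) h) h'

theorem congr_disj {A A' B B' : Tm N κ Γ .truth} (h : Prov (eq A A')) (h' : Prov (eq B B')) :
    Prov (eq (disj A B) (disj A' B')) :=
  congr_app (congr_app (refl _) h) h'

theorem congr_imp {A A' B B' : Tm N κ Γ .truth} (h : Prov (eq A A')) (h' : Prov (eq B B')) :
    Prov (eq (imp A B) (imp A' B')) :=
  congr_app (congr_app (refl _) h) h'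

theorem congr_neg {A A' : Tm N κ Γ .truth} (h : Prov (eq A A')) :
    Prov (eq (neg A) (neg A')) :=
  congr_eq (refl _) h

theorem congr_cat {A A' B B' : Tm N κ Γ Ty.sym} (h : Prov (eq A A')) (h' : Prov (eq B B')) :
    Prov (eq (catT A B) (catT A' B')) :=
  congr_app (congr_app (refl _) h) h'

theorem beta_congr {A : Tm N κ (α :: Γ) β} {B : Tm N κ Γ α} {D : Tm N κ Γ β}
    (h : A.inst B = D) : Prov (eq (app (lam A) B) D) :=
  h ▸ beta A B

theorem beta_beta (A : Tm N κ (β :: α :: Γ) γ) (B : Tm N κ Γ α) (D : Tm N κ Γ β) :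
    Prov (eq (app (app (lam (lam A)) B) D) ((subst (liftSub (instSub B)) A).inst D)) :=
  (congr_app (beta (lam A) B) (refl D)).trans (beta _ D)

theorem tru_intro : Prov (tru : Tm N κ Γ .truth) := refl _

theorem tru_eq_refl (B : Tm N κ Γ α) : Prov (eq tru (eq B B)) := by
  have beta_id : Prov (eq
      (app (weaken (lam (α := α) (bound .here) : Tm N κ Γ _)) (bound .here)) (bound .here)) :=
    beta _ _
  have all_refl : Prov (all (eq (bound .here) (bound .here : Tm N κ (α :: Γ) α))) :=
    eq_mp ((funext (lam (α := α) (bound .here) : Tm N κ Γ _) (lam (bound .here))).trans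
      (congr_all (congr_eq beta_id beta_id))) (refl _)
  exact (beta_congr (A := tru) (B := B) rfl).symm.trans ((congr_app all_refl (refl B)).trans
    (beta_congr (A := eq (bound .here) (bound .here)) rfl))

theorem all_elim {A : Tm N κ (α :: Γ) .truth} (h : Prov (all A)) (B : Tm N κ Γ α) :
    Prov (A.inst B) :=
  eq_mp ((beta_congr (A := tru) (B := B) rfl).symm.trans
    ((congr_app h (refl B)).trans (beta A B))) tru_intro

theorem conj_inst_eq_all (Q : Tm N κ (.truth :: Γ) .truth) :
    Prov (eq (conj (Q.inst tru) (Q.inst fls)) (all Q)) :=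
  (congr_conj (beta Q _) (beta Q _)).symm.trans ((bool (lam Q)).trans
    (congr_all (beta_congr (inst_rename_liftRen_there Q))))

theorem conj_tru_tru : Prov (eq (conj tru tru) (tru : Tm N κ Γ .truth)) :=
  (conj_inst_eq_all (tru : Tm N κ (.truth :: Γ) .truth)).trans (tru_eq_refl _).symm

theorem conj_tru_fls : Prov (eq (conj tru fls) (fls : Tm N κ Γ .truth)) :=
  conj_inst_eq_all (bound .here)

theorem eq_inst_of_truth_cases {A B : Tm N κ (.truth :: Γ) α}
    (hT : Prov (eq (A.inst tru) (B.inst tru))) (hF : Prov (eq (A.inst fls) (B.inst fls)))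
    (P : Tm N κ Γ .truth) : Prov (eq (A.inst P) (B.inst P)) := by
  have tru_eq_eq : ∀ {A B : Tm N κ Γ α}, Prov (eq A B) → Prov (eq tru (eq A B)) :=
    fun h => (tru_eq_refl _).trans (congr_eq (refl _) h)
  have all_eq : Prov (all (eq A B)) :=
    eq_mp ((congr_conj (tru_eq_eq hT) (tru_eq_eq hF)).trans (conj_inst_eq_all (eq A B)))
      (eq_mpr conj_tru_tru tru_intro)
  exact all_elim all_eq P

theorem tru_conj (A : Tm N κ Γ .truth) : Prov (eq (conj tru A) A) :=
  eq_inst_of_truth_cases (A := (conj tru (bound .here) : Tm N κ (.truth :: Γ) _)) (B := bound .here)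
    conj_tru_tru conj_tru_fls A

theorem tru_eq_fls : Prov (eq (eq tru fls) (fls : Tm N κ Γ .truth)) := by
  -- As `fls` is the equation `(λ x, T) = (λ x, x)`, this is an instance of extensionality.
  have fls_eq_all : Prov (eq fls (all (eq tru (bound .here)) : Tm N κ Γ .truth)) :=
    (funext (lam tru : Tm N κ Γ (.fn .truth .truth)) (lam (bound .here))).trans
      (congr_all (congr_eq (beta_congr rfl) (beta_congr rfl)))
  have conj_eq_all : Prov (eq (conj (eq tru tru) (eq tru fls))
      (all (eq tru (bound .here)) : Tm N κ Γ .truth)) :=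
    conj_inst_eq_all (eq tru (bound .here))
  exact (tru_conj _).symm.trans ((congr_conj (tru_eq_refl _) (refl _)).trans
    (conj_eq_all.trans fls_eq_all.symm))

theorem tru_eq (A : Tm N κ Γ .truth) : Prov (eq (eq tru A) A) :=
  eq_inst_of_truth_cases (A := (eq tru (bound .here) : Tm N κ (.truth :: Γ) _)) (B := bound .here)
    (tru_eq_refl _).symm tru_eq_fls A

theorem eq_tru {A : Tm N κ Γ .truth} (h : Prov A) : Prov (eq A tru) :=
  (eq_mpr (tru_eq A) h).symm

theorem inst_of_truth_cases {Q : Tm N κ (.truth :: Γ) .truth} (hT : Prov (Q.inst tru))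
    (hF : Prov (Q.inst fls)) (P : Tm N κ Γ .truth) : Prov (Q.inst P) :=
  eq_mpr (eq_inst_of_truth_cases (B := tru) (eq_tru hT) (eq_tru hF) P) tru_intro

theorem imp_unfold (A B : Tm N κ Γ .truth) : Prov (eq (imp A B) (eq A (conj A B))) := by
  have h := beta_beta (eq (bound (.there .here)) (conj (bound (.there .here)) (bound .here))) A B
  simp only [inst, subst, subst_conj, liftSub, instSub, subst_instSub_weaken] at h
  exact h

theorem disj_unfold (A B : Tm N κ Γ .truth) :
    Prov (eq (disj A B) (neg (conj (neg A) (neg B)))) := by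
  have h := beta_beta (neg (conj (neg (bound (.there .here))) (neg (bound .here)))) A B
  simp only [inst, subst, subst_conj, subst_neg, liftSub, instSub, subst_instSub_weaken] at h
  exact h

theorem tru_imp (A : Tm N κ Γ .truth) : Prov (eq (imp tru A) A) :=
  (imp_unfold _ _).trans ((congr_eq (refl _) (tru_conj A)).trans (tru_eq A))

theorem mp {A B : Tm N κ Γ .truth} (h : Prov (imp A B)) (hA : Prov A) : Prov B :=
  eq_mp ((congr_imp (eq_tru hA) (refl B)).trans (tru_imp B)) h

theorem fls_imp (A : Tm N κ Γ .truth) : Prov (imp fls A) := by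
  -- Leibniz' law for the equation `fls` and the predicate `λ f, f A` gives `fls → T = A`.
  have h := leibniz (lam tru : Tm N κ Γ (.fn .truth .truth)) (lam (bound .here))
    (lam (app (bound .here) (weaken A)))
  refine eq_mp (congr_imp (refl _) ((congr_eq ?_ ?_).trans (tru_eq A))) h
  · exact (beta _ _).trans (beta_congr rfl)
  · exact (beta _ _).trans (beta_congr (inst_weaken _ _))

theorem fls_conj (A : Tm N κ Γ .truth) : Prov (eq (conj fls A) fls) :=
  (eq_mp (imp_unfold _ _) (fls_imp A)).symm

theorem conj_fls (A : Tm N κ Γ .truth) : Prov (eq (conj A fls) fls) :=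
  eq_inst_of_truth_cases (A := (conj (bound .here) fls : Tm N κ (.truth :: Γ) _)) (B := fls)
    conj_tru_fls (fls_conj _) A

theorem fls_eq_tru : Prov (eq (eq fls tru) (fls : Tm N κ Γ .truth)) := by
  have leibniz_eq_fls := leibniz (fls : Tm N κ Γ .truth) tru (lam (eq (bound .here) fls))
  have eq_fls_eq : Prov (eq (eq (eq fls fls) (eq tru fls)) (fls : Tm N κ Γ .truth)) :=
    (congr_eq (tru_eq_refl fls).symm tru_eq_fls).trans tru_eq_fls
  have imp_fls : Prov (imp (eq fls tru) (fls : Tm N κ Γ .truth)) :=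
    eq_mp (congr_imp (refl _) ((congr_eq (beta_congr (D := eq fls fls) rfl)
      (beta_congr (D := eq tru fls) rfl)).trans eq_fls_eq)) leibniz_eq_fls
  exact (eq_mp (imp_unfold _ _) imp_fls).trans (conj_fls _)

end Prov

/-! ### Propositional tautologies -/

/-- Propositional formulas in `m` variables, as syntax for stating tautologies. -/
inductive PropForm (m : ℕ) : Type
  | var : Fin m → PropForm m
  | fls : PropForm m
  | neg : PropForm m → PropForm m
  | conj : PropForm m → PropForm m → PropForm m
  | disj : PropForm m → PropForm m → PropForm m
  | imp : PropForm m → PropForm m → PropForm m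
  | iff : PropForm m → PropForm m → PropForm m

namespace PropForm

variable {m n : ℕ} {C : Ty n → Type u} {Γ Δ : List (Ty n)}

/-- The truth value of a propositional formula under an assignment, by which tautologies are
decided. -/
def eval (b : Fin m → Bool) : PropForm m → Bool
  | var i => b i
  | fls => false
  | neg p => !p.eval b
  | conj p q => p.eval b && q.eval b
  | disj p q => p.eval b || q.eval b
  | imp p q => !p.eval b || q.eval b
  | iff p q => p.eval b == q.eval b

/-- The instance of a propositional formula with the terms `v` for its variables. Equivalence
becomes equality of truth values. -/
def interp (v : Fin m → Term C Γ .truth) : PropForm m → Term C Γ .truth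
  | var i => v i
  | fls => .fls
  | neg p => .neg (p.interp v)
  | conj p q => .conj (p.interp v) (q.interp v)
  | disj p q => .disj (p.interp v) (q.interp v)
  | imp p q => .imp (p.interp v) (q.interp v)
  | iff p q => .eq (p.interp v) (q.interp v)

theorem subst_interp (σ : ∀ α, BVar Γ α → Term C Δ α) (v : Fin m → Term C Γ .truth)
    (p : PropForm m) : (p.interp v).subst σ = p.interp fun i => (v i).subst σ := by
  induction p with
  | var i => rfl
  | fls => rfl
  | neg p ih => simp only [interp, Term.subst_neg, ih]
  | conj p q ihp ihq => simp only [interp, Term.subst_conj, ihp, ihq]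
  | disj p q ihp ihq => simp only [interp, Term.subst_disj, ihp, ihq]
  | imp p q ihp ihq => simp only [interp, Term.subst_imp, ihp, ihq]
  | iff p q ihp ihq => simp only [interp, Term.subst, ihp, ihq]

theorem inst_interp_update (p : PropForm m) (v : Fin m → Term C Γ .truth) (k : Fin m)
    (P : Term C Γ .truth) :
    (p.interp (Function.update (fun i => (v i).weaken) k (.bound .here))).inst P =
      p.interp (Function.update v k P) := by
  rw [Term.inst, subst_interp]
  congr 1
  funext i
  obtain rfl | hi := eq_or_ne i k
  · simp only [Function.update_self, Term.subst, Term.instSub]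
  · simp only [Function.update_of_ne hi, Term.subst_instSub_weaken]

end PropForm

/-- The term that denotes a truth value. -/
def Term.ofBool {n : ℕ} {C : Ty n → Type u} {Γ : List (Ty n)} : Bool → Term C Γ .truth
  | true => tru
  | false => fls

namespace Prov

open Term

variable {n : ℕ} [NeZero n] {N m : ℕ} {κ : Ty n → Type u} {Γ : List (Ty n)}

theorem ofBool_eq (a b : Bool) :
    Prov (eq (eq (ofBool a) (ofBool b)) (ofBool (a == b) : Tm N κ Γ .truth)) := by
  cases a <;> cases b
  exacts [(tru_eq_refl _).symm, fls_eq_tru, tru_eq_fls, (tru_eq_refl _).symm]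

theorem ofBool_neg (a : Bool) : Prov (eq (neg (ofBool a)) (ofBool (!a) : Tm N κ Γ .truth)) := by
  cases a
  exacts [ofBool_eq false false, ofBool_eq false true]

theorem ofBool_conj (a b : Bool) :
    Prov (eq (conj (ofBool a) (ofBool b)) (ofBool (a && b) : Tm N κ Γ .truth)) := by
  cases a
  exacts [fls_conj _, tru_conj _]

theorem ofBool_disj (a b : Bool) :
    Prov (eq (disj (ofBool a) (ofBool b)) (ofBool (a || b) : Tm N κ Γ .truth)) := by
  rw [← Bool.not_not (a || b), Bool.not_or]
  exact (disj_unfold _ _).trans ((congr_neg ((congr_conj (ofBool_neg a) (ofBool_neg b)).trans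
    (ofBool_conj _ _))).trans (ofBool_neg _))

theorem ofBool_imp (a b : Bool) :
    Prov (eq (imp (ofBool a) (ofBool b)) (ofBool (!a || b) : Tm N κ Γ .truth)) := by
  have eq_conj : (!a || b) = (a == (a && b)) := by decide +revert
  rw [eq_conj]
  exact (imp_unfold _ _).trans ((congr_eq (refl _) (ofBool_conj a b)).trans (ofBool_eq _ _))

theorem interp_ofBool (b : Fin m → Bool) (p : PropForm m) :
    Prov (eq (p.interp fun i => ofBool (b i)) (ofBool (p.eval b) : Tm N κ Γ .truth)) := by
  induction p with
  | var i => exact refl _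
  | fls => exact refl _
  | neg p ih => exact (congr_neg ih).trans (ofBool_neg _)
  | conj p q ihp ihq => exact (congr_conj ihp ihq).trans (ofBool_conj _ _)
  | disj p q ihp ihq => exact (congr_disj ihp ihq).trans (ofBool_disj _ _)
  | imp p q ihp ihq => exact (congr_imp ihp ihq).trans (ofBool_imp _ _)
  | iff p q ihp ihq => exact (congr_eq ihp ihq).trans (ofBool_eq _ _)

theorem interp_of_forall_update_ofBool {p : PropForm m} {v : Fin m → Tm N κ Γ .truth}
    (k : Fin m) (h : ∀ c, Prov (p.interp (Function.update v k (ofBool c)))) :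
    Prov (p.interp v) := by
  rw [← Function.update_eq_self k v, ← PropForm.inst_interp_update]
  refine inst_of_truth_cases ?_ ?_ (v k) <;> rw [PropForm.inst_interp_update]
  exacts [h true, h false]

theorem taut (p : PropForm m) (v : Fin m → Tm N κ Γ .truth) (hp : ∀ b, p.eval b = true) :
    Prov (p.interp v) := by
  suffices interp_of_eqOn : ∀ (s : Finset (Fin m)) (b : Fin m → Bool)
      (v : Fin m → Tm N κ Γ .truth), (∀ i ∉ s, v i = ofBool (b i)) → Prov (p.interp v) from
    interp_of_eqOn Finset.univ (fun _ => true) v fun i hi => absurd (Finset.mem_univ i) hi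
  intro s
  induction s using Finset.induction_on with
  | empty =>
    intro b v hv
    obtain rfl : v = fun i => ofBool (b i) := _root_.funext fun i => hv i (Finset.notMem_empty i)
    exact eq_mpr (interp_ofBool b p) (by rw [hp b]; exact tru_intro)
  | insert k s _ ih =>
    intro b v hv
    refine interp_of_forall_update_ofBool k fun c => ih (Function.update b k c) _ fun i hi => ?_
    obtain rfl | hik := eq_or_ne i k
    · simp only [Function.update_self]
    · simp only [Function.update_of_ne hik]
      exact hv i fun hi' => (Finset.mem_insert.mp hi').elim hik hi

variable {A B D H P X Y : Tm N κ Γ .truth}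

theorem imp_refl (A : Tm N κ Γ .truth) : Prov (imp A A) :=
  taut (.imp (.var 0) (.var 0)) ![A] (by decide)

theorem imp_intro (hB : Prov B) : Prov (imp A B) :=
  (taut (.imp (.var 1) (.imp (.var 0) (.var 1))) ![A, B] (by decide)).mp hB

theorem imp_of_neg (hA : Prov (neg A)) : Prov (imp A B) :=
  (taut (.imp (.neg (.var 0)) (.imp (.var 0) (.var 1))) ![A, B] (by decide)).mp hA

theorem imp_trans (h : Prov (imp A B)) (h' : Prov (imp B D)) : Prov (imp A D) :=
  ((taut (.imp (.imp (.var 0) (.var 1)) (.imp (.imp (.var 1) (.var 2)) (.imp (.var 0) (.var 2))))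
    ![A, B, D] (by decide)).mp h).mp h'

theorem imp_eq_mp (h : Prov (imp H (eq A B))) (hA : Prov (imp H A)) : Prov (imp H B) :=
  ((taut (.imp (.imp (.var 0) (.iff (.var 1) (.var 2)))
    (.imp (.imp (.var 0) (.var 1)) (.imp (.var 0) (.var 2)))) ![H, A, B] (by decide)).mp h).mp hA

theorem imp_eq_mpr (h : Prov (imp H (eq A B))) (hB : Prov (imp H B)) : Prov (imp H A) :=
  ((taut (.imp (.imp (.var 0) (.iff (.var 1) (.var 2)))
    (.imp (.imp (.var 0) (.var 2)) (.imp (.var 0) (.var 1)))) ![H, A, B] (by decide)).mp h).mp hB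

theorem contrapose (h : Prov (imp A B)) (hB : Prov (neg B)) : Prov (neg A) :=
  ((taut (.imp (.imp (.var 0) (.var 1)) (.imp (.neg (.var 1)) (.neg (.var 0)))) ![A, B]
    (by decide)).mp h).mp hB

theorem by_cases (P : Tm N κ Γ .truth) (h : Prov (imp P A)) (h' : Prov (imp (neg P) A)) :
    Prov A :=
  ((taut (.imp (.imp (.var 0) (.var 1)) (.imp (.imp (.neg (.var 0)) (.var 1)) (.var 1)))
    ![P, A] (by decide)).mp h).mp h'

theorem conj_intro (hA : Prov A) (hB : Prov B) : Prov (conj A B) :=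
  ((taut (.imp (.var 0) (.imp (.var 1) (.conj (.var 0) (.var 1)))) ![A, B] (by decide)).mp hA).mp hB

theorem conj_imp_left (A B : Tm N κ Γ .truth) : Prov (imp (conj A B) A) :=
  taut (.imp (.conj (.var 0) (.var 1)) (.var 0)) ![A, B] (by decide)

theorem conj_imp_right (A B : Tm N κ Γ .truth) : Prov (imp (conj A B) B) :=
  taut (.imp (.conj (.var 0) (.var 1)) (.var 1)) ![A, B] (by decide)

theorem imp_disj_left (A B : Tm N κ Γ .truth) : Prov (imp A (disj A B)) :=
  taut (.imp (.var 0) (.disj (.var 0) (.var 1))) ![A, B] (by decide)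

theorem imp_disj_right (A B : Tm N κ Γ .truth) : Prov (imp B (disj A B)) :=
  taut (.imp (.var 1) (.disj (.var 0) (.var 1))) ![A, B] (by decide)

theorem disj_imp (h : Prov (imp A D)) (h' : Prov (imp B D)) : Prov (imp (disj A B) D) :=
  ((taut (.imp (.imp (.var 0) (.var 2)) (.imp (.imp (.var 1) (.var 2))
    (.imp (.disj (.var 0) (.var 1)) (.var 2)))) ![A, B, D] (by decide)).mp h).mp h'

theorem disj_map_right (h : Prov (imp A B)) (hD : Prov (disj D A)) : Prov (disj D B) :=
  (disj_imp (imp_disj_left D B) (imp_trans h (imp_disj_right D B))).mp hD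

theorem eq_disj_fls (A : Tm N κ Γ .truth) : Prov (eq A (disj A fls)) :=
  taut (.iff (.var 0) (.disj (.var 0) .fls)) ![A] (by decide)

theorem cases_eq_left (hP : Prov P) : Prov (eq (disj (conj P X) (conj (neg P) Y)) X) :=
  (taut (.imp (.var 0) (.iff (.disj (.conj (.var 0) (.var 1)) (.conj (.neg (.var 0)) (.var 2)))
    (.var 1))) ![P, X, Y] (by decide)).mp hP

theorem cases_eq_right (hP : Prov (neg P)) : Prov (eq (disj (conj P X) (conj (neg P) Y)) Y) :=
  (taut (.imp (.neg (.var 0)) (.iff (.disj (.conj (.var 0) (.var 1))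
    (.conj (.neg (.var 0)) (.var 2))) (.var 2))) ![P, X, Y] (by decide)).mp hP

end Prov

/-! ### Equality and definition by cases -/

/-- Definition by cases: the description of the `x` with `P ∧ A = x ∨ ¬ P ∧ B = x`. -/
def Term.ite {n : ℕ} {C : Ty n → Type u} {Γ : List (Ty n)} {α : Ty n} (P : Term C Γ .truth)
    (A B : Term C Γ α) : Term C Γ α :=
  app (iota α) (lam (disj (conj (weaken P) (eq (weaken A) (bound .here)))
    (conj (neg (weaken P)) (eq (weaken B) (bound .here)))))

theorem Term.subst_ite {n : ℕ} {C : Ty n → Type u} {Γ Δ : List (Ty n)} {α : Ty n}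
    (σ : ∀ α, BVar Γ α → Term C Δ α) (P : Term C Γ .truth) (A B : Term C Γ α) :
    subst σ (ite P A B) = ite (subst σ P) (subst σ A) (subst σ B) := by
  simp only [ite, subst, subst_disj, subst_conj, subst_neg, subst_liftSub_weaken, liftSub]

namespace Prov

open Term

variable {n : ℕ} [NeZero n] {N : ℕ} {κ : Ty n → Type u} {Γ : List (Ty n)} {α β : Ty n}

theorem imp_eq_inst (E : Tm N κ (α :: Γ) β) (A B : Tm N κ Γ α) :
    Prov (imp (eq A B) (eq (E.inst A) (E.inst B))) := by
  have app_eq (D : Tm N κ Γ α) : Prov (eq (app (lam (eq (weaken (E.inst A)) E)) D)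
      (eq (E.inst A) (E.inst D))) :=
    beta_congr (congrArg (eq · (E.inst D)) (inst_weaken _ D))
  exact imp_eq_mp (eq_mp (congr_imp (refl _) (congr_eq (app_eq A) (app_eq B))) (leibniz A B _))
    (imp_intro (refl _))

theorem imp_eq_app (F : Tm N κ Γ (.fn α β)) (A B : Tm N κ Γ α) :
    Prov (imp (eq A B) (eq (app F A) (app F B))) := by
  have h := imp_eq_inst (app (weaken F) (bound .here)) A B
  simp only [inst, subst, instSub, subst_instSub_weaken] at h
  exact h

theorem eq_imp_symm (A B : Tm N κ Γ α) : Prov (imp (eq A B) (eq B A)) := by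
  have h := imp_eq_inst (eq (bound .here) (weaken A)) A B
  simp only [inst, subst, instSub, subst_instSub_weaken] at h
  exact imp_eq_mp h (imp_intro (refl A))

theorem ne_symm {A B : Tm N κ Γ α} (h : Prov (neg (eq A B))) : Prov (neg (eq B A)) :=
  contrapose (eq_imp_symm B A) h

theorem ite_tru (A B : Tm N κ Γ α) : Prov (eq (ite tru A B) A) :=
  (congr_app (refl _) (congr_lam (cases_eq_left tru_intro))).trans (descr A)

theorem ite_fls (A B : Tm N κ Γ α) : Prov (eq (ite fls A B) B) :=
  (congr_app (refl _) (congr_lam (cases_eq_right (refl fls)))).trans (descr B)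

theorem eq_imp_eq_ite (P Q : Tm N κ Γ .truth) (A B : Tm N κ Γ α) :
    Prov (imp (eq P Q) (eq (ite P A B) (ite Q A B))) := by
  have h := imp_eq_inst (ite (bound .here) (weaken A) (weaken B)) P Q
  simp only [inst, subst_ite, subst, instSub, subst_instSub_weaken] at h
  exact h

theorem imp_eq_ite (P : Tm N κ Γ .truth) (A B : Tm N κ Γ α) :
    Prov (imp P (eq A (ite P A B))) :=
  eq_mp (congr_imp (tru_eq P) (congr_eq (ite_tru A B) (refl _))) (eq_imp_eq_ite tru P A B)

theorem neg_imp_eq_ite (P : Tm N κ Γ .truth) (A B : Tm N κ Γ α) :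
    Prov (imp (neg P) (eq B (ite P A B))) :=
  eq_mp (congr_imp (refl _) (congr_eq (ite_fls A B) (refl _))) (eq_imp_eq_ite fls P A B)

theorem app_ite {P : Tm N κ Γ .truth} {Q : Tm N κ Γ (.fn α .truth)} {A B : Tm N κ Γ α}
    (hA : Prov (imp P (app Q A))) (hB : Prov (imp (neg P) (app Q B))) :
    Prov (app Q (ite P A B)) :=
  by_cases P (imp_eq_mp (imp_trans (imp_eq_ite P A B) (imp_eq_app Q _ _)) hA)
    (imp_eq_mp (imp_trans (neg_imp_eq_ite P A B) (imp_eq_app Q _ _)) hB)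

end Prov

/-! ### Words -/

namespace Prov

open Term

variable {n : ℕ} [NeZero n] {N : ℕ} {κ : Ty n → Type u} {Γ : List (Ty n)} {α β γ : Ty n}

theorem cat_nil (A : Tm N κ Γ Ty.sym) : Prov (eq (catT A nilT) A) :=
  (conj_imp_left _ (eq (catT nilT A) A)).mp (all_elim unit A)

theorem nil_cat (A : Tm N κ Γ Ty.sym) : Prov (eq (catT nilT A) A) :=
  (conj_imp_right (eq (catT A nilT) A) _).mp (all_elim unit A)

theorem all_elim₃ {A : Tm N κ (γ :: β :: α :: Γ) .truth} (h : Prov (all (all (all A))))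
    (X : Tm N κ Γ α) (Y : Tm N κ Γ β) (Z : Tm N κ Γ γ) :
    Prov (((A.subst (liftSub (liftSub (instSub X)))).subst (liftSub (instSub Y))).inst Z) :=
  all_elim (all_elim (all_elim h X) Y) Z

theorem cat_assoc (X Y Z : Tm N κ Γ Ty.sym) :
    Prov (eq (catT (catT X Y) Z) (catT X (catT Y Z))) := by
  have h := all_elim₃ assoc X Y Z
  simp only [inst, subst, catT, liftSub, subst_liftSub_weaken, instSub, subst_instSub_weaken] at h
  exact h

theorem letters_ne {a b : Fin N} (hab : a ≠ b) (X Y Z : Tm N κ Γ Ty.sym) :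
    Prov (neg (eq (catT (catT X (letterT a)) Y) (catT (catT X (letterT b)) Z))) := by
  wlog hlt : a < b generalizing a b Y Z
  · exact ne_symm (this hab.symm Z Y (hab.lt_or_gt.resolve_left hlt))
  have h := all_elim₃ (letters a b hlt) X Y Z
  simp only [inst, subst, subst_neg, catT, letterT, liftSub, subst_liftSub_weaken, instSub,
    subst_instSub_weaken] at h
  exact h

theorem wordT_cons (a : Fin N) (w : List (Fin N)) :
    Prov (eq (wordT (a :: w)) (catT (letterT a) (wordT w) : Tm N κ Γ Ty.sym)) := by
  cases w with
  | nil => exact (cat_nil _).symm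
  | cons b w => exact refl _

theorem wordT_append (u v : List (Fin N)) :
    Prov (eq (wordT (u ++ v)) (catT (wordT u) (wordT v) : Tm N κ Γ Ty.sym)) := by
  induction u with
  | nil => exact (nil_cat _).symm
  | cons a u ih =>
    exact (wordT_cons a _).trans ((congr_cat (refl _) ih).trans
      ((cat_assoc _ _ _).symm.trans (congr_cat (wordT_cons a u).symm (refl _))))

theorem wordT_append_cons (x y : List (Fin N)) (a : Fin N) :
    Prov (eq (wordT (x ++ a :: y))
      (catT (catT (wordT x) (letterT a)) (wordT y) : Tm N κ Γ Ty.sym)) :=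
  (wordT_append x (a :: y)).trans
    ((congr_cat (refl _) (wordT_cons a y)).trans (cat_assoc _ _ _).symm)

theorem congr_ne {A A' B B' : Tm N κ Γ α} (hA : Prov (eq A A')) (hB : Prov (eq B B'))
    (h : Prov (neg (eq A' B'))) : Prov (neg (eq A B)) :=
  eq_mpr (congr_neg (congr_eq hA hB)) h

theorem wordT_ne_of_letter_ne {a b : Fin N} (hab : a ≠ b) (x y z : List (Fin N)) :
    Prov (neg (eq (wordT (x ++ a :: y)) (wordT (x ++ b :: z))) : Tm N κ Γ .truth) :=
  congr_ne (wordT_append_cons x y a) (wordT_append_cons x z b) (letters_ne hab _ _ _)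

theorem wordT_ne_of_prefix (hN : N ≠ 1) (x y : List (Fin N)) (a : Fin N) :
    Prov (neg (eq (wordT x) (wordT (x ++ a :: y))) : Tm N κ Γ .truth) := by
  have : Nontrivial (Fin N) := Fin.nontrivial_iff_two_le.mpr (by have := a.pos; omega)
  obtain ⟨b, hb⟩ := exists_ne a
  -- Appending `b` to both words makes them differ at the letter after `x`.
  have append_b (w : List (Fin N)) : Prov (eq
      (app (lam (catT (bound .here) (letterT b))) (wordT w) : Tm N κ Γ Ty.sym)
      (wordT (w ++ [b]))) :=
    (beta_congr (D := catT (wordT w) (letterT b)) rfl).trans (wordT_append w [b]).symm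
  refine contrapose (imp_eq_app _ _ _) (congr_ne (append_b _) (append_b _) ?_)
  rw [List.append_assoc]
  exact wordT_ne_of_letter_ne hb x [] (y ++ [b])

theorem wordT_append_ne (hN : N ≠ 1) (x : List (Fin N)) :
    ∀ {u v : List (Fin N)}, u ≠ v →
      Prov (neg (eq (wordT (x ++ u)) (wordT (x ++ v))) : Tm N κ Γ .truth)
  | [], [], h => absurd rfl h
  | [], b :: v, _ => by simpa only [List.append_nil] using wordT_ne_of_prefix hN x v b
  | a :: u, [], _ => by simpa only [List.append_nil] using ne_symm (wordT_ne_of_prefix hN x u a)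
  | a :: u, b :: v, h => by
    obtain rfl | hab := eq_or_ne a b
    · rw [List.append_cons x a u, List.append_cons x a v]
      exact wordT_append_ne hN (x ++ [a]) fun huv => h (congrArg (a :: ·) huv)
    · exact wordT_ne_of_letter_ne hab x u v

theorem wordT_ne (hN : N ≠ 1) {u v : List (Fin N)} (h : u ≠ v) :
    Prov (neg (eq (wordT u) (wordT v)) : Tm N κ Γ .truth) :=
  wordT_append_ne hN [] h

end Prov

/-! ### Predicate terms -/

/-- The predicate `λ x, x = B₁ ∨ … ∨ x = Bₖ`; for `k = 0` it is `λ x, F`. -/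
def Term.anyOf {n : ℕ} {C : Ty n → Type u} {Γ : List (Ty n)} {α : Ty n} :
    List (Term C Γ α) → Term C Γ (.fn α .truth)
  | [] => lam fls
  | B :: l => predOr (eqTo B) (anyOf l)

namespace Prov

open Term

variable {n : ℕ} [NeZero n] {N : ℕ} {κ : Ty n → Type u} {Γ : List (Ty n)} {α β : Ty n}

theorem eqTo_app (A B : Tm N κ Γ α) : Prov (eq (app (eqTo B) A) (eq A B)) :=
  beta_congr (congrArg (eq A) (inst_weaken B A))

theorem predOr_app (A B : Tm N κ Γ (.fn α .truth)) (X : Tm N κ Γ α) :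
    Prov (eq (app (predOr A B) X) (disj (app A X) (app B X))) :=
  beta_congr (by simp only [inst, subst, subst_disj, instSub, subst_instSub_weaken])

theorem anyOf_nil_app (A : Tm N κ Γ α) : Prov (eq (app (anyOf []) A) fls) :=
  beta fls A

theorem anyOf_cons_app (B : Tm N κ Γ α) (l : List (Tm N κ Γ α)) (A : Tm N κ Γ α) :
    Prov (eq (app (anyOf (B :: l)) A) (disj (eq A B) (app (anyOf l) A))) :=
  (predOr_app _ _ A).trans (congr_disj (eqTo_app A B) (refl _))

theorem cross_app (A : Tm N κ Γ (.fn α .truth)) (B : Tm N κ Γ (.fn β .truth))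
    (X : Tm N κ Γ α) (Y : Tm N κ Γ β) :
    Prov (eq (app (app (cross A B) X) Y) (conj (app A X) (app B Y))) := by
  have h := beta_beta (conj (app (weaken (weaken A)) (bound (.there .here)))
    (app (weaken (weaken B)) (bound .here))) X Y
  simp only [inst, subst, subst_conj, liftSub, subst_liftSub_weaken, instSub,
    subst_instSub_weaken] at h
  exact h

theorem relOr_app (A B : Tm N κ Γ (.fn α (.fn β .truth))) (X : Tm N κ Γ α) :
    Prov (eq (app (relOr A B) X) (predOr (app A X) (app B X))) := by
  refine beta_congr ?_
  simp only [predOr, inst, subst, subst_disj, subst_liftSub_weaken, liftSub, instSub,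
    subst_instSub_weaken]

theorem cross_eqTo_app (A X : Tm N κ Γ α) (B Y : Tm N κ Γ β) :
    Prov (eq (app (app (cross (eqTo A) (eqTo B)) X) Y) (conj (eq X A) (eq Y B))) :=
  (cross_app _ _ X Y).trans (congr_conj (eqTo_app X A) (eqTo_app Y B))

theorem canonicTerm_nil_app (X : Tm N κ [] Ty.sym) (Y : Tm N κ [] α) :
    Prov (eq (app (app (canonicTerm []) X) Y) fls) :=
  beta_beta fls X Y

theorem canonicTerm_cons_app (p : List (Fin N) × Tm N κ [] α)
    (G : List (List (Fin N) × Tm N κ [] α)) (X : Tm N κ [] Ty.sym) (Y : Tm N κ [] α) :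
    Prov (eq (app (app (canonicTerm (p :: G)) X) Y)
      (disj (conj (eq X (wordT p.1)) (eq Y p.2)) (app (app (canonicTerm G) X) Y))) := by
  have head_app := cross_eqTo_app (wordT p.1) X p.2 Y
  cases G with
  | nil =>
    exact head_app.trans
      ((eq_disj_fls _).trans (congr_disj (refl _) (canonicTerm_nil_app X Y).symm))
  | cons q G =>
    exact (congr_app (relOr_app _ _ X) (refl Y)).trans
      ((predOr_app _ _ Y).trans (congr_disj head_app (refl _)))

end Prov

/-! ### The standard model over the free monoid -/

/-- The domains of the standard model: every individual sort denotes the words, the free monoid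
over the alphabet. -/
def Dom (N : ℕ) {n : ℕ} : Ty n → Type
  | .truth => Prop
  | .ind _ => List (Fin N)
  | .fn α β => Dom N α → Dom N β
  | .prod α β => Dom N α × Dom N β

instance Dom.instInhabited (N : ℕ) {n : ℕ} : ∀ α : Ty n, Inhabited (Dom N α)
  | .truth => ⟨True⟩
  | .ind _ => ⟨([] : List (Fin N))⟩
  | .fn _ β => ⟨fun _ => (Dom.instInhabited N β).default⟩
  | .prod α β => ⟨((Dom.instInhabited N α).default, (Dom.instInhabited N β).default)⟩

/-- Values in the standard model for the bound variables of the types in `Γ`. -/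
abbrev Env (N : ℕ) {n : ℕ} (Γ : List (Ty n)) : Type := ∀ α, BVar Γ α → Dom N α

/-- The environment with the value `d` for one further, innermost bound variable. -/
def Env.cons {N n : ℕ} {Γ : List (Ty n)} {γ : Ty n} (d : Dom N γ) (e : Env N Γ) :
    Env N (γ :: Γ)
  | _, .here => d
  | _, .there x => e _ x

section

variable {n : ℕ} [NeZero n] {N : ℕ} {κ : Ty n → Type u}

/-- The denotation of a constant in the standard model; an arbitrary value for the constants of
`κ`, which are not constrained by the axioms. -/
def Const.den : ∀ {α : Ty n}, Const N κ α → Dom N α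
  | _, .nil => ([] : List (Fin N))
  | _, .letter a => [a]
  | _, .cat => fun x y : List (Fin N) => x ++ y
  | _, .other _ => default

/-- The denotation of a term in the standard model, with descriptions as Hilbert's epsilon and an
arbitrary fixed value for the free variables. -/
noncomputable def Term.den : ∀ {Γ : List (Ty n)} {α : Ty n}, Tm N κ Γ α → Env N Γ → Dom N α
  | _, _, .bound x, e => e _ x
  | _, _, .free _ _, _ => default
  | _, _, .const c, _ => c.den
  | _, _, .iota α, _ => Classical.epsilon (α := Dom N α)
  | _, _, .app A B, e => A.den e (B.den e)
  | _, _, .lam A, e => fun d => A.den (e.cons d)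
  | _, _, .eq A B, e => A.den e = B.den e
  | _, _, .pair A B, e => (A.den e, B.den e)
  | _, _, .fst A, e => (A.den e).1
  | _, _, .snd A, e => (A.den e).2

namespace Term

variable {Γ Δ : List (Ty n)} {α γ : Ty n}

theorem den_rename (ρ : ∀ α, BVar Γ α → BVar Δ α) (A : Tm N κ Γ α) (e : Env N Δ) :
    (A.rename ρ).den e = A.den fun α x => e α (ρ α x) := by
  induction A generalizing Δ with
  | lam A ih =>
    simp only [rename, den, ih]
    funext d
    congr 1
    funext β x
    cases x <;> rfl
  | _ => simp_all only [rename, den] <;> rfl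

theorem den_weaken (A : Tm N κ Γ α) (d : Dom N γ) (e : Env N Γ) :
    (weaken A).den (e.cons d) = A.den e :=
  den_rename _ A _

theorem den_subst (σ : ∀ α, BVar Γ α → Tm N κ Δ α) (A : Tm N κ Γ α) (e : Env N Δ) :
    (A.subst σ).den e = A.den fun α x => (σ α x).den e := by
  induction A generalizing Δ with
  | lam A ih =>
    simp only [subst, den, ih]
    funext d
    congr 1
    funext β x
    cases x
    · rfl
    · exact den_weaken _ _ _
  | _ => simp_all only [subst, den] <;> rfl

theorem den_inst (A : Tm N κ (γ :: Γ) α) (B : Tm N κ Γ γ) (e : Env N Γ) :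
    (A.inst B).den e = A.den (e.cons (B.den e)) := by
  rw [inst, den_subst]
  congr 1
  funext β x
  cases x <;> rfl

variable (e : Env N Γ)

theorem den_eq (A B : Tm N κ Γ α) : (eq A B).den e = (A.den e = B.den e) := rfl

theorem den_tru : (tru : Tm N κ Γ .truth).den e = True :=
  eq_self _

theorem den_all (A : Tm N κ (α :: Γ) .truth) :
    (all A).den e = ∀ d : Dom N α, A.den (e.cons d) := by
  change ((fun d => tru.den (e.cons d)) = fun d => A.den (e.cons d)) = _
  have tru_den : (fun d : Dom N α => (tru : Tm N κ _ _).den (e.cons d)) = fun _ => True :=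
    _root_.funext fun d => den_tru _
  rw [tru_den]
  exact propext ⟨fun h d => (congrFun h d).mp trivial,
    fun h => _root_.funext fun d => (eq_true (h d)).symm⟩

theorem den_fls : (fls : Tm N κ Γ .truth).den e = False := by
  rw [fls, den_all]
  exact eq_false fun h => h False

theorem den_neg (A : Tm N κ Γ .truth) : (neg A).den e = ¬ A.den e := by
  rw [neg, den_eq, den_fls]
  exact propext ⟨fun h hA => h.mpr hA, fun h => (eq_false h).symm⟩

theorem den_conj (A B : Tm N κ Γ .truth) : (conj A B).den e = (A.den e ∧ B.den e) := by
  change ((fun g : Prop → Prop → Prop => g (tru.den _) (tru.den _)) =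
    fun g => g (A.den e) (B.den e)) = _
  simp only [den_tru]
  refine propext ⟨fun h => (congrFun h And).mp ⟨trivial, trivial⟩, fun ⟨hA, hB⟩ => ?_⟩
  rw [eq_true hA, eq_true hB]

theorem den_imp (A B : Tm N κ Γ .truth) : (imp A B).den e = (A.den e → B.den e) := by
  change (A.den e = (conj (bound (.there .here)) (bound .here) :
    Tm N κ (.truth :: .truth :: Γ) .truth).den ((e.cons (A.den e)).cons (B.den e))) = _
  rw [den_conj]
  exact propext (eq_iff_iff.trans iff_self_and)

end Term

open Term

theorem Repl.den_eq {Γ₀ : List (Ty n)} {α : Ty n} {A B : Tm N κ Γ₀ α}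
    (h : ∀ e : Env N Γ₀, A.den e = B.den e) {Γ : List (Ty n)} {β : Ty n} {D E : Tm N κ Γ β}
    (r : Repl A B D E) (e : Env N Γ) : D.den e = E.den e := by
  induction r with
  | here => exact h e
  | lam _ ih => exact funext fun d => ih _
  | _ => simp_all only [Term.den] <;> rfl

theorem Prov.sound {Γ : List (Ty n)} {A : Tm N κ Γ .truth} (h : Prov A) (e : Env N Γ) :
    A.den e := by
  induction h with
  | bool G =>
    rw [den_eq, den_conj, den_all]
    simp only [Term.den, den_weaken, den_tru, den_fls]
    exact propext Prop.forall.symm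
  | leibniz A B H =>
    rw [den_imp]
    exact congrArg (H.den e)
  | funext F G =>
    rw [den_eq, den_all]
    simp only [Term.den, den_weaken]
    exact propext funext_iff
  | beta A B => exact (den_inst A B e).symm
  | descr A =>
    change Classical.epsilon (fun d => (weaken A).den (e.cons d) = d) = A.den e
    simp only [den_weaken]
    exact (Classical.epsilon_spec (p := fun d => A.den e = d) ⟨_, rfl⟩).symm
  | fst_pair A B => rfl
  | snd_pair A B => rfl
  | pair_eta A => rfl
  | unit =>
    simp only [den_all, den_conj]
    exact fun x => ⟨List.append_nil (α := Fin N) x, List.nil_append (α := Fin N) x⟩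
  | assoc =>
    simp only [den_all]
    exact List.append_assoc (α := Fin N)
  | letters a b hab =>
    simp only [den_all, den_neg]
    have append_ne (x y z : List (Fin N)) : x ++ [a] ++ y ≠ x ++ [b] ++ z := fun h =>
      hab.ne (by simpa using h : a = b ∧ y = z).1
    exact append_ne
  | ruleR _ _ r ihAB ihD => exact (r.den_eq ihAB e).mp (ihD e)

theorem not_prov_fls : ¬ Prov (fls : Tm N κ [] .truth) := fun h =>
  (den_fls _).mp (h.sound fun _ x => nomatch x)

end

/-! ### Conservativity of new constants -/

namespace Term

variable {n : ℕ} {C : Ty n → Type u} {C' : Ty n → Type v} {Γ Δ : List (Ty n)} {α γ : Ty n}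

/-- A term without loose bound variables, regarded inside the binders listed in `Γ`. -/
def lift (A : Term C [] α) : Term C Γ α :=
  rename (Γ := []) nofun A

/-- The translation of terms that substitutes the term `g α c` for each constant `c` of type
`α`. -/
def bindConst (g : ∀ α, C α → Term C' [] α) : ∀ {Γ : List (Ty n)} {α : Ty n},
    Term C Γ α → Term C' Γ α
  | _, _, bound x => bound x
  | _, _, free α i => free α i
  | _, _, const c => (g _ c).lift
  | _, _, iota α => iota α
  | _, _, app A B => app (bindConst g A) (bindConst g B)
  | _, _, lam A => lam (bindConst g A)
  | _, _, eq A B => eq (bindConst g A) (bindConst g B)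
  | _, _, pair A B => pair (bindConst g A) (bindConst g B)
  | _, _, fst A => fst (bindConst g A)
  | _, _, snd A => snd (bindConst g A)

theorem subst_lift (σ : ∀ α, BVar Γ α → Term C Δ α) (A : Term C [] α) :
    subst σ A.lift = A.lift := by
  rw [lift, lift, subst_rename, rename_eq_subst]
  congr 1
  funext α x
  cases x

theorem rename_lift (ρ : ∀ α, BVar Γ α → BVar Δ α) (A : Term C [] α) :
    rename ρ A.lift = A.lift := by
  rw [rename_eq_subst, subst_lift]

variable (g : ∀ α, C α → Term C' [] α)

theorem bindConst_rename (ρ : ∀ α, BVar Γ α → BVar Δ α) (A : Term C Γ α) :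
    (rename ρ A).bindConst g = rename ρ (A.bindConst g) := by
  induction A generalizing Δ with
  | const c => exact (rename_lift ρ _).symm
  | _ => simp_all only [rename, bindConst]

theorem bindConst_weaken (A : Term C Γ α) :
    (weaken (γ := γ) A).bindConst g = weaken (A.bindConst g) :=
  bindConst_rename g _ A

theorem bindConst_subst (σ : ∀ α, BVar Γ α → Term C Δ α) (A : Term C Γ α) :
    (subst σ A).bindConst g = subst (fun α x => (σ α x).bindConst g) (A.bindConst g) := by
  induction A generalizing Δ with
  | const c => exact (subst_lift _ _).symm
  | lam A ih =>
    simp only [subst, bindConst, ih]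
    congr 2
    funext α x
    cases x
    · rfl
    · exact bindConst_weaken g _
  | _ => simp_all only [subst, bindConst]

theorem bindConst_inst (A : Term C (γ :: Γ) α) (B : Term C Γ γ) :
    (A.inst B).bindConst g = (A.bindConst g).inst (B.bindConst g) := by
  rw [inst, inst, bindConst_subst]
  congr 1
  funext α x
  cases x <;> rfl

theorem mapConst_eq_bindConst (f : ∀ α, C α → C' α) (A : Term C Γ α) :
    A.mapConst f = A.bindConst fun α c => const (f α c) := by
  induction A with
  | const c => rfl
  | _ => simp_all only [mapConst, bindConst]

theorem bindConst_mapConst {f : ∀ α, C' α → C α} (hgf : ∀ α c, g α (f α c) = const c)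
    (A : Term C' Γ α) : (A.mapConst f).bindConst g = A := by
  induction A with
  | const c => simp only [mapConst, bindConst, hgf, lift, rename]
  | _ => simp_all only [mapConst, bindConst]

theorem mapConst_weaken (f : ∀ α, C α → C' α) (A : Term C Γ α) :
    (weaken (γ := γ) A).mapConst f = weaken (A.mapConst f) := by
  simp only [mapConst_eq_bindConst, bindConst_weaken]

variable {β : Ty n} (f : ∀ α, C α → C' α)

theorem mapConst_eqTo (A : Term C Γ α) : (eqTo A).mapConst f = eqTo (A.mapConst f) := by
  rw [eqTo, eqTo, ← mapConst_weaken]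
  rfl

theorem mapConst_cross (A : Term C Γ (.fn α .truth)) (B : Term C Γ (.fn β .truth)) :
    (cross A B).mapConst f = cross (A.mapConst f) (B.mapConst f) := by
  simp only [cross, ← mapConst_weaken]
  rfl

theorem mapConst_predOr (A B : Term C Γ (.fn α .truth)) :
    (predOr A B).mapConst f = predOr (A.mapConst f) (B.mapConst f) := by
  simp only [predOr, ← mapConst_weaken]
  rfl

theorem mapConst_relOr (A B : Term C Γ (.fn α (.fn β .truth))) :
    (relOr A B).mapConst f = relOr (A.mapConst f) (B.mapConst f) := by
  simp only [relOr, mapConst, mapConst_predOr, mapConst_weaken]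

end Term

section

open Term

variable {n : ℕ} [NeZero n] {N : ℕ} {κ : Ty n → Type u} {κ' : Ty n → Type v} {Γ : List (Ty n)}
  {α : Ty n}

/-- The extension of a translation `g` of the further constants to all constants, which fixes
those of the symbolic type. -/
def Const.bind (g : ∀ α, κ α → Tm N κ' [] α) : ∀ α, Const N κ α → Tm N κ' [] α
  | _, .nil => nilT
  | _, .letter a => letterT a
  | _, .cat => .const .cat
  | _, .other c => g _ c

theorem Repl.bindConst (g : ∀ α, Const N κ α → Tm N κ' [] α) {Γ₀ : List (Ty n)} {β : Ty n}
    {A B : Tm N κ Γ₀ α} {D E : Tm N κ Γ β} (r : Repl A B D E) :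
    Repl (A.bindConst g) (B.bindConst g) (D.bindConst g) (E.bindConst g) := by
  induction r with
  | here => exact .here
  | appL _ _ ih => exact .appL _ ih
  | appR _ _ ih => exact .appR _ ih
  | lam _ ih => exact .lam ih
  | eqL _ _ ih => exact .eqL _ ih
  | eqR _ _ ih => exact .eqR _ ih
  | pairL _ _ ih => exact .pairL _ ih
  | pairR _ _ ih => exact .pairR _ ih
  | fst _ ih => exact .fst ih
  | snd _ ih => exact .snd ih

theorem Prov.bindConst (g : ∀ α, κ α → Tm N κ' [] α) {A : Tm N κ Γ .truth} (h : Prov A) :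
    Prov (A.bindConst (Const.bind g)) := by
  induction h with
  | bool G =>
    have h := Prov.bool (G.bindConst (Const.bind g))
    rw [← bindConst_weaken] at h
    exact h
  | leibniz A B H => exact .leibniz (A.bindConst _) (B.bindConst _) (H.bindConst _)
  | funext F G =>
    have h := Prov.funext (F.bindConst (Const.bind g)) (G.bindConst (Const.bind g))
    rw [← bindConst_weaken, ← bindConst_weaken] at h
    exact h
  | beta A B => exact beta_congr (bindConst_inst _ A B).symm
  | descr A =>
    have h := Prov.descr (A.bindConst (Const.bind g))
    rw [← bindConst_weaken] at h
    exact h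
  | fst_pair A B => exact .fst_pair _ _
  | snd_pair A B => exact .snd_pair _ _
  | pair_eta A => exact .pair_eta _
  | unit => exact .unit
  | assoc => exact .assoc
  | letters a b hab => exact .letters a b hab
  | ruleR _ _ r ihAB ihD => exact .ruleR ihAB ihD (r.bindConst _)

variable (ξ : Ty n → Type v)

theorem prov_toExt {A : Tm N κ Γ .truth} (h : Prov A) : Prov (toExt ξ A) := by
  have toExt_eq_bind : (fun α (c : Const N κ α) => .const (Const.toExt ξ α c)) =
      Const.bind (κ' := extend κ ξ) fun _ c => .const (.other (.inl c)) := by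
    funext α c
    cases c <;> rfl
  rw [toExt, mapConst_eq_bindConst, toExt_eq_bind]
  exact h.bindConst _

/-- The translation of the constants of an extension that puts free variables for the new
ones. -/
def retractExt : ∀ α, extend κ ξ α → Tm N κ [] α
  | _, .inl c => .const (.other c)
  | α, .inr _ => .free α 0

theorem prov_toExt_iff {A : Tm N κ Γ .truth} : Prov (toExt ξ A) ↔ Prov A := by
  refine ⟨fun h => ?_, prov_toExt ξ⟩
  have h' := h.bindConst (retractExt ξ)
  rwa [toExt, bindConst_mapConst _ fun α c => by cases c <;> rfl] at h'

theorem toExt_wordT (w : List (Fin N)) : toExt ξ (wordT w : Tm N κ Γ _) = wordT w := by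
  induction w with
  | nil => rfl
  | cons a w ih =>
    cases w with
    | nil => rfl
    | cons b w => exact congrArg (catT (letterT a)) ih

theorem toExt_cross_eqTo (p : List (Fin N) × Tm N κ [] α) :
    toExt ξ (cross (eqTo (wordT p.1)) (eqTo p.2)) =
      cross (eqTo (wordT p.1)) (eqTo (toExt ξ p.2)) := by
  rw [← toExt_wordT ξ p.1]
  simp only [toExt, mapConst_cross, mapConst_eqTo]

theorem toExt_canonicTerm (G : List (List (Fin N) × Tm N κ [] α)) :
    toExt ξ (canonicTerm G) = canonicTermExt ξ G := by
  induction G with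
  | nil => rfl
  | cons p G ih =>
    cases G with
    | nil => exact toExt_cross_eqTo ξ p
    | cons q G =>
      exact (mapConst_relOr _ _ _).trans (congrArg₂ relOr (toExt_cross_eqTo ξ p) ih)

end

/-! ### Canonic representations and lexicons -/

section

open Term Prov

variable {n : ℕ} [NeZero n] {N : ℕ} {κ : Ty n → Type u} {α : Ty n}

/-- The language represented by `R`, a term without new constants. -/
def langOf (R : Tm N κ [] (.fn Ty.sym (.fn α .truth))) : Lang N κ α :=
  {p | Prov (app (app R (wordT p.1)) p.2)}

theorem logicallyClosed_langOf (R : Tm N κ [] (.fn Ty.sym (.fn α .truth))) :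
    LogicallyClosed (langOf R) := fun w A B D hB hD h =>
  (disj_imp (imp_eq_mpr (leibniz A B (app R (wordT w))) (imp_intro hB))
    (imp_eq_mpr (leibniz A D (app R (wordT w))) (imp_intro hD))).mp h

theorem LogicallyClosed.mem_of_prov_anyOf {L : Lang N κ α} (hL : LogicallyClosed L)
    {w : List (Fin N)} {l : List (Tm N κ [] α)} (hl : ∀ B ∈ l, (w, B) ∈ L) {A : Tm N κ [] α}
    (h : Prov (app (anyOf l) A)) : (w, A) ∈ L := by
  induction l generalizing A with
  | nil => exact absurd (eq_mp (anyOf_nil_app A) h) not_prov_fls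
  | cons B l ih =>
    obtain ⟨hB, hl⟩ := List.forall_mem_cons.mp hl
    have hdisj := eq_mp (anyOf_cons_app B l A) h
    cases l with
    | nil =>
      have anyOf_imp := eq_mpr (congr_imp (anyOf_nil_app A) (refl (eq A B))) (fls_imp _)
      exact hL w A B B hB hB (disj_map_right anyOf_imp hdisj)
    | cons B' l =>
      let P := app (anyOf (B' :: l)) A
      have anyOf_head : Prov (app (anyOf (B' :: l)) B') :=
        eq_mpr (anyOf_cons_app B' l B') ((imp_disj_left _ _).mp (refl B'))
      have hD : (w, ite P A B') ∈ L := ih hl (app_ite (imp_refl P) (imp_intro anyOf_head))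
      exact hL w A B _ hB hD (disj_map_right (imp_eq_ite P A B') hdisj)

theorem prov_canonicTerm_imp_anyOf (hN : N ≠ 1) (G : List (List (Fin N) × Tm N κ [] α))
    (w : List (Fin N)) (A : Tm N κ [] α) :
    Prov (imp (app (app (canonicTerm G) (wordT w)) A)
      (app (anyOf ((G.filter fun p => p.1 = w).map Prod.snd)) A)) := by
  induction G with
  | nil => exact eq_mpr (congr_imp (canonicTerm_nil_app _ A) (refl _)) (fls_imp _)
  | cons p G ih =>
    refine eq_mpr (congr_imp (canonicTerm_cons_app p G _ A) (refl _)) ?_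
    by_cases hp : p.1 = w
    · rw [List.filter_cons_of_pos (by exact decide_eq_true hp), List.map_cons]
      refine eq_mpr (congr_imp (refl _) (anyOf_cons_app p.2 _ A)) ?_
      exact disj_imp (imp_trans (conj_imp_right _ _) (imp_disj_left _ _))
        (imp_trans ih (imp_disj_right _ _))
    · rw [List.filter_cons_of_neg (by rwa [decide_eq_true_iff])]
      exact disj_imp (imp_trans (conj_imp_left _ _) (imp_of_neg (wordT_ne hN (Ne.symm hp)))) ih

theorem mem_langOf_canonicTerm {G : List (List (Fin N) × Tm N κ [] α)}
    {p : List (Fin N) × Tm N κ [] α} (hp : p ∈ G) : p ∈ langOf (canonicTerm G) := by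
  induction G with
  | nil => exact absurd hp List.not_mem_nil
  | cons q G ih =>
    refine eq_mpr (canonicTerm_cons_app q G _ _) ?_
    obtain rfl | hp := List.mem_cons.mp hp
    · exact (imp_disj_left _ _).mp (conj_intro (refl _) (refl _))
    · exact (imp_disj_right _ _).mp (ih hp)

theorem isLogicalClosure_langOf_canonicTerm (hN : N ≠ 1)
    (G : List (List (Fin N) × Tm N κ [] α)) :
    IsLogicalClosure (langOf (canonicTerm G)) {p | p ∈ G} := by
  refine ⟨⟨logicallyClosed_langOf _, fun p => mem_langOf_canonicTerm⟩, ?_⟩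
  rintro L ⟨hL, hG⟩ ⟨w, A⟩ h
  refine hL.mem_of_prov_anyOf (fun B hB => ?_) ((prov_canonicTerm_imp_anyOf hN G w A).mp h)
  obtain ⟨p, hp, rfl⟩ := List.mem_map.mp hB
  obtain ⟨hpG, hpw⟩ := List.mem_filter.mp hp
  exact of_decide_eq_true hpw ▸ hG hpG

variable {ξ : Ty n → Type v} {L : Lang N κ α}

theorem represents_toExt_iff {R : Tm N κ [] (.fn Ty.sym (.fn α .truth))} :
    Represents ξ (toExt ξ R) L ↔ L = langOf R := by
  have prov_iff (w : List (Fin N)) (A : Tm N κ [] α) :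
      Prov (app (app (toExt ξ R) (wordT w)) (toExt ξ A)) ↔ (w, A) ∈ langOf R := by
    rw [← toExt_wordT ξ w]
    exact prov_toExt_iff ξ (A := app (app R (wordT w)) A)
  simp only [Represents, prov_iff, Set.ext_iff, Prod.forall]

theorem represents_canonicTermExt_iff (hN : N ≠ 1) {G : List (List (Fin N) × Tm N κ [] α)} :
    Represents ξ (canonicTermExt ξ G) L ↔ IsLogicalClosure L {p | p ∈ G} := by
  have closure_G := isLogicalClosure_langOf_canonicTerm hN G
  rw [← toExt_canonicTerm, represents_toExt_iff]
  exact ⟨fun h => h ▸ closure_G, fun h => h.unique closure_G⟩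

theorem Represents.of_prov_eq {R R' : Tm N (extend κ ξ) [] (.fn Ty.sym (.fn α .truth))}
    (hR : Represents ξ R L) (h : Prov (eq R R')) : Represents ξ R' L := fun w A =>
  have app_eq := congr_app (congr_app h (refl (wordT w))) (refl (toExt ξ A))
  (hR w A).trans ⟨eq_mp app_eq, eq_mpr app_eq⟩

theorem hasCanonicRep_iff :
    HasCanonicRep ξ L ↔ ∃ G : List (List (Fin N) × Tm N κ [] α),
      Represents ξ (canonicTermExt ξ G) L :=
  ⟨fun ⟨_, hR, G, h⟩ => ⟨G, hR.of_prov_eq h⟩, fun ⟨G, hG⟩ => ⟨_, hG, G, refl _⟩⟩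

theorem isLexicon_iff :
    IsLexicon L ↔ ∃ G : List (List (Fin N) × Tm N κ [] α), IsLogicalClosure L {p | p ∈ G} := by
  refine ⟨fun ⟨S, hS, hL⟩ => ⟨hS.toFinset.toList, ?_⟩, fun ⟨G, hG⟩ => ⟨_, G.finite_toSet, hG⟩⟩
  simpa only [Finset.mem_toList, Set.Finite.mem_toFinset, Set.ofPred_mem_eq] using hL

end

end TyN

theorem theorem6p4 {n : ℕ} [NeZero n] {N : ℕ} (hN : N ≠ 1) {κ : TyN.Ty n → Type u}
    (ξ : TyN.Ty n → Type v) {α : TyN.Ty n} (L : TyN.Lang N κ α)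
    (hL : TyN.LogicallyClosed L) :
    (TyN.HasCanonicRep ξ L ↔ TyN.IsLexicon L) ∧
      ∀ G : List (List (Fin N) × TyN.Tm N κ [] α),
        TyN.IsLogicalClosure L {p | p ∈ G} → TyN.Represents ξ (TyN.canonicTermExt ξ G) L :=
  ⟨by simp only [TyN.hasCanonicRep_iff, TyN.isLexicon_iff,
      TyN.represents_canonicTermExt_iff hN],
    fun _ => (TyN.represents_canonicTermExt_iff hN).mpr⟩
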